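/- For integers $v,k,g,\lambda$, an $egr(v,k,g,\lambda)$-graph (edge-girth-regular graph) is a finite simple $k$-regular graph on $v$ vertices with girth $g$ (the length of a shortest cycle) such that every edge is contained in exactly $\lambda$ cycles of length $g$. **Theorem.** There is no $egr(v,3,7,6)$-graph, for any $v$. In other words, there is no finite cubic graph of girth $7$, connected or not, in which every edge is contained in exactly $6$ cycles of length $7$. -/

import Mathlib

namespace SimpleGraph

/-- The cycles of length `g` of the graph `G` that contain the edge `e`. A cycle is a subgraph
(so that its starting vertex and its direction play no role). -/
def cyclesThroughEdge {V : Type*} (G : SimpleGraph V) (g : ℕ) (e : Sym2 V) : Set G.Subgraph :=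
  {C | (∃ (u : V) (p : G.Walk u u), p.IsCycle ∧ p.length = g ∧ p.toSubgraph = C) ∧ e ∈ C.edgeSet}

/-- `G` is an edge-girth-regular `(v, k, g, l)`-graph: a `k`-regular (finite, simple) graph of
girth `g` on `v` vertices such that every edge is contained in exactly `l` cycles of length `g`. -/
structure IsEdgeGirthRegular {V : Type*} [Fintype V] (G : SimpleGraph V) [DecidableRel G.Adj]
    (v k g l : ℕ) : Prop where
  card_eq : Fintype.card V = v
  regular : G.IsRegularOfDegree k
  girth_eq : G.egirth = (g : ℕ∞)
  cycles_eq : ∀ e ∈ G.edgeSet, (G.cyclesThroughEdge g e).encard = (l : ℕ∞)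

end SimpleGraph

/-! In girth 7 a 4-path lies in at most one heptagon. The numbers of heptagons through the three
2-paths centred at a vertex have pairwise sums 6, so each is 3: exactly one of the four extensions
of a 2-path to a 4-path, its gap, does not close (`hasUniqueGaps`). Strength of a 3-path does not
depend on the end at which it is tested (`strong_symm`), each 2-path has one strong continuation
(`existsUnique_strong`), and a 4-path closes iff it contains a strong 3-path (`closes_iff`). Hence
every 3-path lies in a heptagon (`exists_closes`).

Strong continuations label the tree of radius 3 about a vertex `v` with neighbours `p`, `q`, `r`.
The closing rules then force edges between leaves of different branches, depending only on one bit,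
`Linked`, for each ordered pair of neighbours. Consecutive links are excluded by short cycles
(`not_linked_rot`). In `exists_linked`, `linked_symm` and `not_linked`, a pattern of bits yields a
3-path in no heptagon; together they exclude every pattern. -/

namespace SimpleGraph

variable {V : Type*} {G : SimpleGraph V}

/-! ### Gaps and strong 3-paths -/

/-- The neighbours of `v` are the three distinct vertices `p`, `q`, `r`. -/
structure Tri (G : SimpleGraph V) (v p q r : V) : Prop where
  pq : p ≠ q
  pr : p ≠ r
  qr : q ≠ r
  adj_iff : ∀ x, G.Adj v x ↔ x = p ∨ x = q ∨ x = r

namespace Tri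

variable {v p q r : V}

lemma rot (T : Tri G v p q r) : Tri G v q r p :=
  ⟨T.qr, T.pq.symm, T.pr.symm, fun x => by rw [T.adj_iff]; tauto⟩

lemma swap (T : Tri G v p q r) : Tri G v q p r :=
  ⟨T.pq.symm, T.qr, T.pr, fun x => by rw [T.adj_iff]; tauto⟩

lemma adj (T : Tri G v p q r) : G.Adj v p := (T.adj_iff p).2 (Or.inl rfl)

lemma of_ne (T : Tri G v p q r) {x : V} (h : G.Adj v x) (hx : x ≠ p) : x = q ∨ x = r :=
  ((T.adj_iff x).1 h).resolve_left hx

end Tri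

/-- The `4`-path `s a x y t` is contained in a heptagon. -/
def Closes (G : SimpleGraph V) (s a _x y t : V) : Prop :=
  ∃ p q, G.Adj s p ∧ p ≠ a ∧ G.Adj p q ∧ G.Adj q t ∧ q ≠ y

lemma Closes.symm {s a x y t : V} (h : Closes G s a x y t) : Closes G t y x a s := by
  obtain ⟨p, q, h1, h2, h3, h4, h5⟩ := h
  exact ⟨q, p, h4.symm, h5, h3.symm, h1.symm, h2⟩

/-- The `3`-path `a x y b` is contained in a heptagon together with either of the two edges that
extend it beyond `b`. -/
def Strong (G : SimpleGraph V) (a x y b : V) : Prop :=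
  ∀ c, G.Adj b c → c ≠ y → Closes G a x y b c

/-- A cubic graph of girth at least `7` in which each `2`-path is contained in exactly three
heptagons: all but one of its four extensions to a `4`-path close up. -/
structure HasUniqueGaps (G : SimpleGraph V) : Prop where
  c3 : ∀ {a b c}, G.Adj a b → G.Adj b c → G.Adj c a → False
  c4 : ∀ {a b c d}, G.Adj a b → G.Adj b c → G.Adj c d → G.Adj d a → a = c ∨ b = d
  c5 : ∀ {a b c d e}, G.Adj a b → G.Adj b c → G.Adj c d → G.Adj d e → G.Adj e a → False
  c6 : ∀ {a b c d e f}, G.Adj a b → G.Adj b c → G.Adj c d → G.Adj d e → G.Adj e f → G.Adj f a →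
    a = c ∨ b = d ∨ c = e ∨ d = f ∨ e = a ∨ f = b
  tri : ∀ {v p}, G.Adj v p → ∃ q r, Tri G v p q r
  gap : ∀ {a x y}, G.Adj x a → G.Adj x y → a ≠ y →
    ∃ s t, G.Adj a s ∧ s ≠ x ∧ G.Adj y t ∧ t ≠ x ∧ ¬ Closes G s a x y t ∧
      ∀ s' t', G.Adj a s' → s' ≠ x → G.Adj y t' → t' ≠ x → ¬ Closes G s' a x y t' →
        s' = s ∧ t' = t

namespace HasUniqueGaps

variable (H : HasUniqueGaps G)
include H

/-- The two heptagons through `a x y b` leave `a` by different edges, since otherwise their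
remaining arcs would form a hexagon. So both extensions beyond `a` close as well. -/
lemma strong_symm {a x y b : V} (hxa : G.Adj x a) (hxy : G.Adj x y) (hyb : G.Adj y b)
    (hay : a ≠ y) (h : Strong G a x y b) : Strong G b y x a := by
  obtain ⟨b1, b2, Tb⟩ := H.tri hyb.symm
  obtain ⟨p, q, h1, h2, h3, h4, h5⟩ := h b1 Tb.rot.adj Tb.pq.symm
  obtain ⟨p', q', h1', h2', h3', h4', h5'⟩ := h b2 Tb.rot.rot.adj Tb.pr.symm
  have hpp : p ≠ p' := by
    rintro rfl
    rcases H.c6 h3 h4 Tb.rot.adj.symm Tb.rot.rot.adj h4'.symm h3'.symm with e | e | e | e | e | e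
    · subst e; exact H.c5 h1 Tb.rot.adj.symm hyb.symm hxy.symm hxa
    · exact h5 e
    · exact Tb.qr e
    · exact h5' e.symm
    · subst e; exact H.c5 h1 Tb.rot.rot.adj.symm hyb.symm hxy.symm hxa
    · subst e
      rcases H.c4 h4 Tb.rot.adj.symm Tb.rot.rot.adj h4'.symm with e | e
      · exact h5 e
      · exact Tb.qr e
  intro c hc hcx
  obtain ⟨c1, c2, Tc⟩ := H.tri hxa.symm
  have key : c = p ∨ c = p' := by
    rcases Tc.of_ne hc hcx with rfl | rfl <;> rcases Tc.of_ne h1 h2 with rfl | rfl <;>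
    rcases Tc.of_ne h1' h2' with rfl | rfl <;> simp_all
  rcases key with rfl | rfl
  · exact ⟨b1, q, Tb.rot.adj, Tb.pq.symm, h4.symm, h3.symm, by
      rintro rfl; exact H.c5 hxa h4 Tb.rot.adj.symm hyb.symm hxy.symm⟩
  · exact ⟨b2, q', Tb.rot.rot.adj, Tb.pr.symm, h4'.symm, h3'.symm, by
      rintro rfl; exact H.c5 hxa h4' Tb.rot.rot.adj.symm hyb.symm hxy.symm⟩

/-- Every `2`-path has exactly one strong continuation. -/
lemma existsUnique_strong {a x y : V} (hxa : G.Adj x a) (hxy : G.Adj x y) (hay : a ≠ y) :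
    ∃! b, G.Adj y b ∧ b ≠ x ∧ Strong G a x y b := by
  obtain ⟨s, t, hs, hsx, ht, htx, hgap, huniq⟩ := H.gap hxa hxy hay
  obtain ⟨c1, c2, Tc⟩ := H.tri hxy.symm
  obtain ⟨b, hb, hbx, hbt, hall⟩ : ∃ b, G.Adj y b ∧ b ≠ x ∧ b ≠ t ∧
      ∀ z, G.Adj y z → z ≠ x → z = b ∨ z = t := by
    rcases Tc.of_ne ht htx with rfl | rfl
    · exact ⟨c2, Tc.rot.rot.adj, Tc.pr.symm, Tc.qr.symm, fun z hz hzx => (Tc.of_ne hz hzx).symm⟩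
    · exact ⟨c1, Tc.rot.adj, Tc.pq.symm, Tc.qr, fun z hz hzx => Tc.of_ne hz hzx⟩
  refine ⟨b, ⟨hb, hbx, ?_⟩, ?_⟩
  -- The gap of `a x y` ends in `t`, not in `b`, so the reversed path `b y x a` is strong.
  · refine H.strong_symm hb hxy.symm hxa hbx fun c hc hcx => ?_
    by_contra hn
    exact hbt (huniq c b hc hcx hb hbx fun h => hn h.symm).2
  · rintro z ⟨hz, hzx, hst⟩
    refine (hall z hz hzx).resolve_right ?_
    rintro rfl
    exact hgap (H.strong_symm hxa hxy hz hay hst s hs hsx).symm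

/-- If neither 3-path is strong, each has a failing extension, and uniqueness of the gap of `x y b`
identifies `a` and `c` with its two ends. -/
lemma closes_iff {a x y b c : V} (hxa : G.Adj x a) (hxy : G.Adj x y) (hyb : G.Adj y b)
    (hbc : G.Adj b c) (hay : a ≠ y) (hbx : b ≠ x) (hcy : c ≠ y) :
    Closes G a x y b c ↔ Strong G a x y b ∨ Strong G x y b c := by
  obtain ⟨s, t, hs, hsx, ht, htx, hgap, huniq⟩ := H.gap hxy.symm hyb hbx.symm
  constructor
  · intro h
    by_contra hn
    push Not at hn
    obtain ⟨h1, h2⟩ := hn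
    have e1 : a = s := by
      unfold Strong at h1
      push Not at h1
      obtain ⟨c', hc', hcy', hn⟩ := h1
      exact (huniq a c' hxa hay hc' hcy' hn).1
    have e2 : c = t := by
      have h3 : ¬ Strong G c b y x := fun h3 =>
        h2 (H.strong_symm hbc hyb.symm hxy.symm hcy h3)
      unfold Strong at h3
      push Not at h3
      obtain ⟨a', ha', hay', hn⟩ := h3
      exact (huniq a' c ha' hay' hbc hcy fun h => hn h.symm).2
    subst e1 e2
    exact hgap h
  · rintro (h | h)
    · exact h c hbc hcy
    · exact (H.strong_symm hxy.symm hyb hbc hbx.symm h a hxa hay).symm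

/-- Every `3`-path is contained in a heptagon. -/
lemma exists_closes {a x y b : V} (hxa : G.Adj x a) (hxy : G.Adj x y) (hyb : G.Adj y b)
    (hay : a ≠ y) (hbx : b ≠ x) : ∃ c, G.Adj b c ∧ c ≠ y ∧ Closes G a x y b c := by
  obtain ⟨c, ⟨hc, hcy, hst⟩, -⟩ := H.existsUnique_strong hxy.symm hyb hbx.symm
  exact ⟨c, hc, hcy, (H.closes_iff hxa hxy hyb hc hay hbx hcy).2 (Or.inr hst)⟩

end HasUniqueGaps

open Classical in
/-- The strong continuation of the `2`-path `a x y`. -/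
noncomputable def next (G : SimpleGraph V) (a x y : V) : V :=
  -- By `existsUnique_strong` the default `y` never occurs for a genuine 2-path.
  if h : ∃ b, G.Adj y b ∧ b ≠ x ∧ Strong G a x y b then h.choose else y

namespace HasUniqueGaps

variable (H : HasUniqueGaps G)
include H

lemma next_spec {a x y : V} (hxa : G.Adj x a) (hxy : G.Adj x y) (hay : a ≠ y) :
    G.Adj y (next G a x y) ∧ next G a x y ≠ x ∧ Strong G a x y (next G a x y) := by
  have h := (H.existsUnique_strong hxa hxy hay).exists
  rw [next, dif_pos h]
  exact h.choose_spec

lemma eq_next {a x y b : V} (hxa : G.Adj x a) (hxy : G.Adj x y) (hay : a ≠ y)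
    (hyb : G.Adj y b) (hbx : b ≠ x) (h : Strong G a x y b) : b = next G a x y :=
  (H.existsUnique_strong hxa hxy hay).unique ⟨hyb, hbx, h⟩ (H.next_spec hxa hxy hay)

/-- Reversed, a common continuation `b` would give the 2-path `b y x` two strong continuations. So
strength matches the far neighbours of `x` bijectively with those of `y`. -/
lemma next_ne {a a' x y : V} (hxa : G.Adj x a) (hxa' : G.Adj x a') (hxy : G.Adj x y)
    (hay : a ≠ y) (hay' : a' ≠ y) (haa : a ≠ a') : next G a x y ≠ next G a' x y := by
  intro e
  obtain ⟨h1, h2, h3⟩ := H.next_spec hxa hxy hay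
  have h4 := (H.next_spec hxa' hxy hay').2.2
  rw [← e] at h4
  exact haa ((H.existsUnique_strong h1 hxy.symm h2).unique
    ⟨hxa, hay, H.strong_symm hxa hxy h1 hay h3⟩
    ⟨hxa', hay', H.strong_symm hxa' hxy h1 hay' h4⟩)

/-- Two neighbours `p`, `p'` of distinct neighbours of a vertex have no common neighbour. -/
lemma no_common {X u p u' Y z : V} (h1 : G.Adj X u) (h2 : G.Adj u p) (h3 : G.Adj p u')
    (h4 : G.Adj u' Y) (huu : u ≠ u') (hX : X ≠ p) (hY : Y ≠ p) (h5 : G.Adj X z)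
    (h6 : G.Adj z Y) : False := by
  have key : ∀ {X Y : V}, G.Adj X u → G.Adj X u' → X ≠ p → False := fun h h' hX =>
    (H.c4 h h2 h3 h'.symm).elim hX huu
  rcases H.c6 h1 h2 h3 h4 h6.symm h5.symm with e | e | e | e | e | e
  · exact hX e
  · exact huu e
  · exact hY e.symm
  · subst e; exact key (Y := X) h1 h5 hX
  · subst e; exact key (Y := Y) h1 h4.symm hX
  · subst e; exact key (Y := Y) h6.symm h4.symm hY

/-- A vertex at distance three from `v` has a unique neighbour at distance two. -/
lemma no_second_parent {X u p v q u' : V} (h1 : G.Adj X u) (h2 : G.Adj u p) (h3 : G.Adj p v)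
    (h4 : G.Adj v q) (h5 : G.Adj q u') (hX : X ≠ p) (hu : u ≠ v) (hpq : p ≠ q) (hu' : u' ≠ v)
    (h6 : G.Adj X u') : False := by
  have key : ¬ G.Adj q u := fun h => (H.c4 h2 h3 h4 h).elim hu hpq
  rcases H.c6 h1 h2 h3 h4 h5 h6.symm with e | e | e | e | e | e
  · exact hX e
  · exact hu e
  · exact hpq e
  · exact hu' e.symm
  · subst e; exact key h1
  · subst e; exact key h5

lemma mem_of_adj {y a b c x : V} (ha : G.Adj y a) (hb : G.Adj y b) (hc : G.Adj y c)
    (hab : a ≠ b) (hac : a ≠ c) (hbc : b ≠ c) (hx : G.Adj y x) : x = a ∨ x = b ∨ x = c := by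
  obtain ⟨q, r, T⟩ := H.tri ha
  rcases T.of_ne hb hab.symm with rfl | rfl <;> rcases T.of_ne hc hac.symm with rfl | rfl <;>
  rcases (T.adj_iff x).1 hx with h | h | h <;> simp_all

end HasUniqueGaps

/-! ### The labelled tree of radius three and edges between its leaves -/

/-- The neighbour of `p` that continues the `2`-path `q v p` strongly. -/
noncomputable def snd (G : SimpleGraph V) (v p q : V) : V := next G q v p

/-- The neighbour of `snd G v p q` that continues the path from `v` strongly. -/
noncomputable def strongLeaf (G : SimpleGraph V) (v p q : V) : V := next G v p (snd G v p q)

/-- The neighbour of `snd G v p q` that continues the path from `v` weakly, where `r` is the third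
neighbour of `v`. -/
noncomputable def weakLeaf (G : SimpleGraph V) (v p q r : V) : V :=
  next G (snd G v p r) p (snd G v p q)

/-- The strong leaves below `snd G v p q` and `snd G v q r` are adjacent. -/
def Linked (G : SimpleGraph V) (v p q r : V) : Prop :=
  G.Adj (strongLeaf G v p q) (strongLeaf G v q r)

namespace HasUniqueGaps

variable (H : HasUniqueGaps G) {v p q r : V} (T : Tri G v p q r)
include H T

local notation "U" => snd G v
local notation "A" => strongLeaf G v
local notation "B" => weakLeaf G v

lemma tri_snd : Tri G p v (U p q) (U p r) := by
  have h1 := H.next_spec T.rot.adj T.adj T.pq.symm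
  have h2 := H.next_spec T.rot.rot.adj T.adj T.pr.symm
  have h3 := H.next_ne T.rot.adj T.rot.rot.adj T.adj T.pq.symm T.pr.symm T.qr
  exact ⟨h1.2.1.symm, h2.2.1.symm, h3, fun x =>
    ⟨H.mem_of_adj T.adj.symm h1.1 h2.1 h1.2.1.symm h2.2.1.symm h3, by
      rintro (rfl | rfl | rfl)
      exacts [T.adj.symm, h1.1, h2.1]⟩⟩

lemma tri_leaf : Tri G (U p q) p (A p q) (B p q r) := by
  have T' := H.tri_snd T
  have h1 := H.next_spec T'.adj T'.rot.adj T'.pq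
  have h2 := H.next_spec T'.rot.rot.adj T'.rot.adj T'.qr.symm
  have h3 := H.next_ne T'.adj T'.rot.rot.adj T'.rot.adj T'.pq T'.qr.symm T'.pr
  exact ⟨h1.2.1.symm, h2.2.1.symm, h3, fun x =>
    ⟨H.mem_of_adj T'.rot.adj.symm h1.1 h2.1 h1.2.1.symm h2.2.1.symm h3, by
      rintro (rfl | rfl | rfl)
      exacts [T'.rot.adj.symm, h1.1, h2.1]⟩⟩

lemma strong_snd : Strong G (U p q) p v q := by
  have h1 := H.next_spec T.rot.adj T.adj T.pq.symm
  exact H.strong_symm T.rot.adj T.adj h1.1 T.pq.symm h1.2.2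

lemma not_strong_snd : ¬ Strong G p v q (U q r) := fun h => by
  have T' := H.tri_snd T.rot
  exact T'.qr (H.eq_next T.adj T.rot.adj T.pq T'.rot.adj T'.pq.symm h)

/-- The path `U p q, p, v, q` is strong, so its extension to `w` closes; `X` and `Y` are the other
two vertices of the heptagon. -/
lemma exists_adj_leaf {w : V} (hw : G.Adj q w) (hwv : w ≠ v) :
    ∃ X Y, (X = A p q ∨ X = B p q r) ∧ G.Adj X Y ∧ G.Adj w Y ∧ Y ≠ q := by
  have T1 := H.tri_snd T
  have T2 := H.tri_leaf T
  obtain ⟨X, Y, h1, h2, h3, h4, h5⟩ := H.strong_snd T w hw hwv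
  exact ⟨X, Y, T2.of_ne h1 h2, h3, h4.symm, h5⟩

/-- The heptagon through `U p q, p, v, q, U q r` also contains `p, v, q, U q r, Y`. As `p, v, q, U q
r` is not strong, `v, q, U q r, Y` must be, which forces `Y = A q r`. -/
lemma strongLeaf_adj : G.Adj (A p q) (A q r) ∨ G.Adj (B p q r) (A q r) := by
  have T1 := H.tri_snd T
  have T1' := H.tri_snd T.rot
  have T2 := H.tri_leaf T
  obtain ⟨X, Y, h1, h2, h3, h4⟩ := H.exists_adj_leaf T T1'.rot.adj T1'.pq.symm
  have hX : G.Adj (U p q) X := by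
    rcases h1 with rfl | rfl
    exacts [T2.rot.adj, T2.rot.rot.adj]
  have hc : Closes G p v q (U q r) Y := ⟨U p q, X, T1.rot.adj, T1.pq.symm, hX, h2, by
    rintro rfl
    exact H.c5 T1.rot.adj hX T1'.rot.adj.symm T.rot.adj.symm T.adj⟩
  have hY : Y = A q r := by
    rcases (H.closes_iff T.adj T.rot.adj T1'.rot.adj h3 T.pq T1'.pq.symm h4).1 hc with h | h
    · exact (H.not_strong_snd T h).elim
    · exact H.eq_next T1'.adj T1'.rot.adj T1'.pq h3 h4 h
  subst hY
  rcases h1 with rfl | rfl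
  exacts [Or.inl h2, Or.inr h2]

lemma exists_adj_other_leaf :
    ∃ X Y, (X = A p q ∨ X = B p q r) ∧ (Y = A q p ∨ Y = B q p r) ∧ G.Adj X Y := by
  have T1 := H.tri_snd T.swap
  obtain ⟨X, Y, h1, h2, h3, h4⟩ := H.exists_adj_leaf T T1.rot.adj T1.pq.symm
  exact ⟨X, Y, h1, (H.tri_leaf T.swap).of_ne h3 h4, h2⟩

/-- Such an edge would close the path `U p r, p, v, q, U q r`, neither of whose 3-paths is strong.
-/
lemma not_adj_of_weak {X Y : V} (h1 : G.Adj (U p r) X) (h2 : X ≠ p) (h3 : G.Adj (U q r) Y)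
    (h4 : Y ≠ q) : ¬ G.Adj X Y := by
  intro h5
  have T1 := H.tri_snd T
  have T1' := H.tri_snd T.rot
  have hc : Closes G (U p r) p v q (U q r) := ⟨X, Y, h1, h2, h5, h3.symm, h4⟩
  rcases (H.closes_iff T1.rot.rot.adj T.adj.symm T.rot.adj T1'.rot.adj T1.pr.symm T.pq.symm
    T1'.pq.symm).1 hc with h | h
  · exact H.not_strong_snd T.swap
      (H.strong_symm T1.rot.rot.adj T.adj.symm T.rot.adj T1.pr.symm h)
  · exact H.not_strong_snd T h

/-- Leaves in the same branch but below different vertices have no common neighbour. -/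
lemma no_common_leaf {X Y z : V} (h1 : G.Adj (U p q) X) (h2 : X ≠ p) (h3 : G.Adj (U p r) Y)
    (h4 : Y ≠ p) (h5 : G.Adj X z) (h6 : G.Adj z Y) : False :=
  have T1 := H.tri_snd T
  H.no_common h1.symm T1.rot.adj.symm T1.rot.rot.adj h3 T1.qr h2 h4 h5 h6

/-- A leaf below `U p _` is not adjacent to `U q _`. -/
lemma not_adj_snd {u u' X : V} (h1 : G.Adj p u) (h2 : u ≠ v) (h3 : G.Adj u X) (h4 : X ≠ p)
    (h5 : G.Adj q u') (h6 : u' ≠ v) : ¬ G.Adj X u' :=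
  fun h => H.no_second_parent h3.symm h1.symm T.adj.symm T.rot.adj h5 h4 h2 T.pq h6 h

/-- One of the two leaves below `U p q` is adjacent to `A q r`, and the other one to a leaf below
`U q p`. -/
lemma leaf_edges : (G.Adj (A p q) (A q r) ∧ ¬ G.Adj (B p q r) (A q r) ∧
      (G.Adj (B p q r) (A q p) ∨ G.Adj (B p q r) (B q p r))) ∨
    (G.Adj (B p q r) (A q r) ∧ ¬ G.Adj (A p q) (A q r) ∧
      (G.Adj (A p q) (A q p) ∨ G.Adj (A p q) (B q p r))) := by
  have T2 := H.tri_leaf T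
  have T2' := H.tri_leaf T.rot
  have T2'' := H.tri_leaf T.swap
  have hn : ¬ (G.Adj (A p q) (A q r) ∧ G.Adj (B p q r) (A q r)) := fun ⟨h1, h2⟩ => by
    rcases H.c4 T2.rot.adj h1 h2.symm T2.rot.rot.adj.symm with h | h
    · exact H.c5 (h ▸ (H.tri_snd T).rot.adj) T2'.rot.adj.symm (H.tri_snd T.rot).rot.adj.symm
        T.rot.adj.symm T.adj
    · exact T2.qr h
  have key : ∀ X Y, (Y = A q p ∨ Y = B q p r) → G.Adj X Y → ¬ G.Adj X (A q r) := by
    intro X Y hY h1 h2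
    refine H.no_common_leaf T.rot T2'.rot.adj T2'.pq.symm ?_ ?_ h2.symm h1
    · rcases hY with rfl | rfl
      exacts [T2''.rot.adj, T2''.rot.rot.adj]
    · rcases hY with rfl | rfl
      exacts [T2''.pq.symm, T2''.pr.symm]
  obtain ⟨X, Y, hX, hY, h⟩ := H.exists_adj_other_leaf T
  have hXY := key X Y hY h
  rcases hX with rfl | rfl
  · refine Or.inr ⟨(H.strongLeaf_adj T).resolve_left hXY, hXY, ?_⟩
    rcases hY with rfl | rfl
    exacts [Or.inl h, Or.inr h]
  · refine Or.inl ⟨(H.strongLeaf_adj T).resolve_right hXY, hXY, ?_⟩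
    rcases hY with rfl | rfl
    exacts [Or.inl h, Or.inr h]

lemma weak_adj_of_not_linked (h : ¬ Linked G v p q r) : G.Adj (B p q r) (A q r) :=
  (H.strongLeaf_adj T).resolve_left h

lemma not_adj_of_linked {X : V} (h : Linked G v q p r) (h1 : G.Adj (U p q) X) (h2 : X ≠ p) :
    ¬ G.Adj X (A q p) := fun h3 => by
  have T2 := H.tri_leaf T.swap.rot
  exact H.no_common_leaf T h1 h2 T2.rot.adj T2.pq.symm h3 h

lemma not_adj_of_not_linked {X : V} (h : ¬ Linked G v q p r) (h1 : G.Adj (U p q) X)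
    (h2 : X ≠ p) : ¬ G.Adj X (B q p r) := fun h3 => by
  have T2 := H.tri_leaf T.swap.rot
  exact H.no_common_leaf T h1 h2 T2.rot.adj T2.pq.symm h3 (H.weak_adj_of_not_linked T.swap h)

/-- Here and in the next two lemmas, the edge between the leaves below `U p q` and `U q p` joins the
one not adjacent to `A q r` to the one not adjacent to `A p r`. -/
lemma weak_adj_weak (h : Linked G v p q r) (h' : Linked G v q p r) :
    G.Adj (B p q r) (B q p r) := by
  have T2 := H.tri_leaf T
  rcases H.leaf_edges T with ⟨-, -, h1⟩ | ⟨-, h1, -⟩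
  · exact h1.resolve_left (H.not_adj_of_linked T h' T2.rot.rot.adj T2.pr.symm)
  · exact (h1 h).elim

lemma weak_adj_strong (h : Linked G v p q r) (h' : ¬ Linked G v q p r) :
    G.Adj (B p q r) (A q p) := by
  have T2 := H.tri_leaf T
  rcases H.leaf_edges T with ⟨-, -, h1⟩ | ⟨-, h1, -⟩
  · exact h1.resolve_right (H.not_adj_of_not_linked T h' T2.rot.rot.adj T2.pr.symm)
  · exact (h1 h).elim

lemma strong_adj_strong (h : ¬ Linked G v p q r) (h' : ¬ Linked G v q p r) :
    G.Adj (A p q) (A q p) := by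
  have T2 := H.tri_leaf T
  rcases H.leaf_edges T with ⟨h1, -, -⟩ | ⟨-, -, h1⟩
  · exact (h h1).elim
  · exact h1.resolve_right (H.not_adj_of_not_linked T h' T2.rot.adj T2.pq.symm)

/-- `A p q` is adjacent to a leaf below `U r p`, so two consecutive links would complete a triangle
or a pentagon. -/
lemma not_linked_rot (h : Linked G v p q r) : ¬ Linked G v q r p := fun h' => by
  have T2 := H.tri_leaf T.rot.rot
  rcases H.strongLeaf_adj T.rot.rot with h1 | h1
  · exact H.c3 h h' h1
  · exact H.c5 h h' T2.rot.adj.symm T2.rot.rot.adj h1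

lemma weak_adj_rot (h : Linked G v p q r) : G.Adj (B r p q) (A p q) :=
  H.weak_adj_of_not_linked T.rot.rot fun h' => H.not_linked_rot T.rot.rot h' h

/-- With `exists_partner`, this supplies the neighbours needed in `eq_of_adj_strongLeaf`. -/
lemma exists_cross : ∃ Y, G.Adj (A q r) Y ∧ G.Adj (U p q) Y ∧ Y ≠ p := by
  have T2 := H.tri_leaf T
  rcases H.strongLeaf_adj T with h | h
  exacts [⟨_, h.symm, T2.rot.adj, T2.pq.symm⟩, ⟨_, h.symm, T2.rot.rot.adj, T2.pr.symm⟩]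

lemma exists_partner (h : ¬ Linked G v p q r) :
    ∃ M, G.Adj (A p q) M ∧ G.Adj (U q p) M ∧ M ≠ q := by
  have T2 := H.tri_leaf T.swap
  rcases H.leaf_edges T with ⟨h1, -, -⟩ | ⟨-, -, h1 | h1⟩
  exacts [(h h1).elim, ⟨_, h1, T2.rot.adj, T2.pq.symm⟩, ⟨_, h1, T2.rot.rot.adj, T2.pr.symm⟩]

/-- The neighbours of `A p q` are `U p q` and one leaf in each of the other two branches. -/
lemma eq_of_adj_strongLeaf {X Y u u' x : V} (hX : G.Adj (A p q) X) (hX1 : G.Adj u X)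
    (hX2 : X ≠ q) (hu : G.Adj q u) (huv : u ≠ v) (hY : G.Adj (A p q) Y) (hY1 : G.Adj u' Y)
    (hu' : G.Adj r u') (huv' : u' ≠ v)
    (hx : G.Adj (A p q) x) (hxu : x ≠ U p q) : x = X ∨ x = Y := by
  have T1 := H.tri_snd T
  have T2 := H.tri_leaf T
  refine (H.mem_of_adj T2.rot.adj.symm hX hY ?_ ?_ ?_ hx).resolve_left hxu
  · rintro rfl
    exact H.c5 T1.rot.adj hX1.symm hu.symm T.rot.adj.symm T.adj
  · rintro rfl
    exact H.c5 T1.rot.adj hY1.symm hu'.symm T.rot.rot.adj.symm T.adj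
  · rintro rfl
    exact H.not_adj_snd T.rot hu huv hX1 hX2 hu' huv' hY1.symm

/-! ### Excluding the patterns of links -/

/-- Linking is not absent from a whole cyclic triple: otherwise no heptagon contains the `3`-path
`A p q, U p q, B p q r, A q r`. -/
lemma exists_linked (h1 : ¬ Linked G v p q r) (h2 : ¬ Linked G v q r p)
    (h3 : ¬ Linked G v r p q) : False := by
  have Up := H.tri_snd T
  have Uq := H.tri_snd T.rot
  have Ur := H.tri_snd T.rot.rot
  have Apq := H.tri_leaf T
  have Aqr := H.tri_leaf T.rot
  have Arp := H.tri_leaf T.rot.rot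
  have Aqp := H.tri_leaf T.swap
  have Arq := H.tri_leaf T.swap.rot.rot
  have Bpq := H.weak_adj_of_not_linked T h1
  have Bqr := H.weak_adj_of_not_linked T.rot h2
  have Brp := H.weak_adj_of_not_linked T.rot.rot h3
  obtain ⟨M, hM, hM1, hM2⟩ := H.exists_partner T h1
  obtain ⟨M', hM', hM1', hM2'⟩ := H.exists_partner T.rot h2
  obtain ⟨c, hc, hcb, x, z, hx, hxu, hxz, hzc, hz⟩ :=
    H.exists_closes Apq.rot.adj Apq.rot.rot.adj Bpq Apq.qr fun h =>
      H.c5 Up.rot.adj (h ▸ Aqr.rot.adj.symm) Uq.rot.adj.symm T.rot.adj.symm T.adj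
  have hxc := H.eq_of_adj_strongLeaf T hM hM1 hM2 Uq.rot.rot.adj Uq.pr.symm Brp.symm
    Arp.rot.rot.adj Ur.rot.adj Ur.pq.symm hx hxu
  have hcc : c = U q r ∨ c = M' := by
    by_contra hn
    push Not at hn
    rcases H.eq_of_adj_strongLeaf T.rot hM' hM1' hM2' Ur.rot.rot.adj Ur.pr.symm Bpq.symm
      Apq.rot.rot.adj Up.rot.adj Up.pq.symm hc hn.1 with h | h
    exacts [hn.2 h, hcb h]
  rcases hxc with rfl | rfl <;> rcases hcc with rfl | rfl
  · exact H.c5 hxz hzc Uq.rot.adj.symm Uq.rot.rot.adj hM1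
  -- Either way one of the two leaves is strong: `M = A q p` in the linked case, `M' = A r q`
  -- otherwise. The neighbours of that leaf are then known, which leaves few candidates for `z`.
  · by_cases h : Linked G v r q p
    · obtain ⟨Y, hY, hY1, -⟩ := H.exists_cross T.swap.rot.rot
      have hqp := H.not_linked_rot T.swap.rot.rot h
      obtain rfl := (Aqp.of_ne hM1 hM2).resolve_right fun e =>
        H.not_adj_of_not_linked T hqp Apq.rot.adj Apq.pq.symm (e ▸ hM)
      by_cases hzu : z = U q p
      · subst hzu
        exact H.not_adj_snd T.swap.rot.rot Ur.rot.rot.adj Ur.pr.symm hM1' hM2' Uq.rot.rot.adj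
          Uq.pr.symm hzc.symm
      · rcases H.eq_of_adj_strongLeaf T.swap hM.symm Apq.rot.adj Apq.pq.symm Up.rot.adj
          Up.pq.symm hY hY1 Ur.rot.rot.adj Ur.pr.symm hxz hzu with rfl | rfl
        · exact H.c5 hzc hM'.symm Bpq.symm Apq.rot.rot.adj.symm Apq.rot.adj
        · exact H.c3 hzc hM1'.symm hY1
    · obtain ⟨Y, hY, hY1, hY2⟩ := H.exists_cross T.swap.rot
      obtain rfl := (Arq.of_ne hM1' hM2').resolve_right fun e =>
        H.not_adj_of_not_linked T.rot h Aqr.rot.adj Aqr.pq.symm (e ▸ hM')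
      by_cases hzu : z = U r q
      · subst hzu
        exact H.not_adj_snd T.rot Uq.rot.rot.adj Uq.pr.symm hM1 hM2 Ur.rot.rot.adj Ur.pr.symm hxz
      · rcases H.eq_of_adj_strongLeaf T.swap.rot.rot hM'.symm Aqr.rot.adj Aqr.pq.symm Uq.rot.adj
          Uq.pq.symm hY hY1 Up.rot.rot.adj Up.pr.symm hzc.symm hzu with rfl | rfl
        · exact hz rfl
        · exact H.no_common_leaf T Apq.rot.adj Apq.pq.symm hY1 hY2 hM hxz
  · rcases (Aqr.adj_iff z).1 hzc.symm with rfl | rfl | rfl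
    · exact H.c5 hxz T.rot.adj.symm T.rot.rot.adj Ur.rot.adj Arp.rot.rot.adj
    · exact hz rfl
    · rcases H.c4 Bqr Arp.rot.adj.symm Arp.rot.rot.adj hxz with h | h
      · exact H.c5 (h ▸ Aqr.rot.rot.adj) Ur.rot.adj.symm T.rot.rot.adj.symm T.rot.adj Uq.rot.adj
      · exact Arp.qr h
  · exact H.no_common_leaf T.rot.rot Arp.rot.rot.adj Arp.pr.symm hM1' hM2' hxz hzc

/-- Otherwise no heptagon contains the `3`-path `A p q, U p q, B p q r, A q p`. -/
lemma linked_symm (h : Linked G v p q r) : Linked G v q p r := by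
  by_contra h'
  have h2 := H.not_linked_rot T h
  have Up := H.tri_snd T
  have Uq := H.tri_snd T.rot
  have Ur := H.tri_snd T.rot.rot
  have Apq := H.tri_leaf T
  have Aqr := H.tri_leaf T.rot
  have Arp := H.tri_leaf T.rot.rot
  have Aqp := H.tri_leaf T.swap
  have Brp := H.weak_adj_rot T h
  have Bpq := H.weak_adj_strong T h h'
  obtain ⟨N, hN, hN1, hN2⟩ := H.exists_cross T.swap.rot.rot
  obtain ⟨M, hM, hM1, hM2⟩ := H.exists_partner T.rot h2
  obtain ⟨c, hc, hcb, x, z, hx, hxu, hxz, hzc, hz⟩ :=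
    H.exists_closes Apq.rot.adj Apq.rot.rot.adj Bpq Apq.qr fun h =>
      H.c5 Up.rot.adj (h ▸ Aqp.rot.adj.symm) Uq.rot.rot.adj.symm T.rot.adj.symm T.adj
  have hxc := H.eq_of_adj_strongLeaf T h Aqr.rot.adj Aqr.pq.symm Uq.rot.adj Uq.pq.symm Brp.symm
    Arp.rot.rot.adj Ur.rot.adj Ur.pq.symm hx hxu
  have hcc : c = U q p ∨ c = N := by
    by_contra hn
    push Not at hn
    rcases H.eq_of_adj_strongLeaf T.swap Bpq.symm Apq.rot.rot.adj Apq.pr.symm Up.rot.adj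
      Up.pq.symm hN hN1 Ur.rot.rot.adj Ur.pr.symm hc hn.1 with h | h
    exacts [hcb h, hn.2 h]
  rcases hxc with rfl | rfl <;> rcases hcc with rfl | rfl
  · exact H.c5 hxz hzc Uq.rot.rot.adj.symm Uq.rot.adj Aqr.rot.adj
  · exact H.c5 hxz hzc hN1.symm hM1 hM.symm
  · rcases (Aqp.adj_iff z).1 hzc.symm with rfl | rfl | rfl
    · exact H.c5 hxz T.rot.adj.symm T.rot.rot.adj Ur.rot.adj Arp.rot.rot.adj
    · exact hz rfl
    · exact H.not_adj_of_weak T.rot Aqp.rot.rot.adj Aqp.pr.symm Arp.rot.rot.adj Arp.pr.symm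
        hxz.symm
  · exact H.no_common_leaf T.rot.rot Arp.rot.rot.adj Arp.pr.symm hN1 hN2 hxz hzc

/-- Otherwise no heptagon contains the `3`-path `U q r, q, U q p, A q p`. -/
lemma not_linked (h : Linked G v q r p) : False := by
  have h' := H.linked_symm T.rot h
  -- The branches `q` and `r` are linked both ways, and this rules out the links that would adjoin
  -- them in a cyclic triple.
  have hpq : ¬ Linked G v p q r := fun h1 => H.not_linked_rot T h1 h
  have hqp := H.not_linked_rot T.swap.rot.rot h'
  have Up := H.tri_snd T
  have Uq := H.tri_snd T.rot
  have Ur := H.tri_snd T.rot.rot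
  have Apq := H.tri_leaf T
  have Aqr := H.tri_leaf T.rot
  have Arp := H.tri_leaf T.rot.rot
  have Aqp := H.tri_leaf T.swap
  have Arq := H.tri_leaf T.swap.rot.rot
  have Bpq := H.weak_adj_of_not_linked T hpq
  have Brp := H.weak_adj_of_not_linked T.rot.rot (H.not_linked_rot T.rot h)
  have Bqr := H.weak_adj_weak T.rot h h'
  have Mpq := H.strong_adj_strong T hpq hqp
  obtain ⟨c, hc, hcb, x, z, hx, hxu, hxz, hzc, hz⟩ :=
    H.exists_closes Uq.rot.adj Uq.rot.rot.adj Aqp.rot.adj Uq.qr Aqp.pq.symm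
  have hcc := H.eq_of_adj_strongLeaf T.swap Mpq.symm Apq.rot.adj Apq.pq.symm Up.rot.adj
      Up.pq.symm h'.symm Arq.rot.adj Ur.rot.rot.adj Ur.pr.symm hc hcb
  rcases Aqr.of_ne hx hxu with rfl | rfl <;> rcases hcc with rfl | rfl
  · exact H.c5 hxz hzc Apq.rot.adj.symm Apq.rot.rot.adj Bpq
  · by_cases hzu : z = U q r
    · subst hzu
      exact H.not_adj_snd T.swap.rot.rot Ur.rot.rot.adj Ur.pr.symm Arq.rot.adj Arq.pq.symm
        Uq.rot.adj Uq.pq.symm hzc.symm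
    · rcases H.eq_of_adj_strongLeaf T.rot h Arp.rot.adj Arp.pq.symm Ur.rot.adj Ur.pq.symm Bpq.symm
        Apq.rot.rot.adj Up.rot.adj Up.pq.symm hxz hzu with rfl | rfl
      · exact H.c5 hzc Arq.rot.adj.symm Ur.rot.rot.adj.symm Ur.rot.adj Arp.rot.adj
      · exact H.c5 hzc h' Mpq.symm Apq.rot.adj.symm Apq.rot.rot.adj
  · by_cases hzu : z = U p q
    · subst hzu
      exact H.not_adj_snd T.swap Uq.rot.adj Uq.pq.symm Aqr.rot.rot.adj Aqr.pr.symm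
        Up.rot.adj Up.pq.symm hxz
    · rcases H.eq_of_adj_strongLeaf T Mpq Aqp.rot.adj Aqp.pq.symm Uq.rot.rot.adj Uq.pr.symm
        Brp.symm Arp.rot.rot.adj Ur.rot.adj Ur.pq.symm hzc.symm hzu with rfl | rfl
      · exact hz rfl
      · exact H.no_common_leaf T.rot.rot Arp.rot.rot.adj Arp.pr.symm Arq.rot.rot.adj Arq.pr.symm
          hxz.symm Bqr
  · exact H.c5 hxz hzc Arq.rot.adj.symm Arq.rot.rot.adj Bqr.symm

/-- No vertex of such a graph has a neighbour. -/
lemma not_tri : False :=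
  H.exists_linked T (fun h => H.not_linked T.rot.rot h) (fun h => H.not_linked T h)
    fun h => H.not_linked T.rot h

end HasUniqueGaps

/-! ### Short closed walks and heptagons -/

section Girth

variable (hg : ∀ (a : V) (w : G.Walk a a), w.IsCycle → 7 ≤ w.length)
include hg

lemma not_triangle {a b c : V} (h1 : G.Adj a b) (h2 : G.Adj b c) (h3 : G.Adj c a) : False := by
  have h := hg a (.cons h1 (.cons h2 (.cons h3 .nil))) (by
    have := h1.ne; have := h2.ne; have := h3.ne
    simp [Walk.cons_isCycle_iff, Walk.cons_isPath_iff]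
    grind)
  simp at h

lemma eq_or_eq_of_square {a b c d : V} (h1 : G.Adj a b) (h2 : G.Adj b c) (h3 : G.Adj c d)
    (h4 : G.Adj d a) : a = c ∨ b = d := by
  by_contra hn
  have h := hg a (.cons h1 (.cons h2 (.cons h3 (.cons h4 .nil)))) (by
    have := h1.ne; have := h2.ne; have := h3.ne; have := h4.ne
    simp [Walk.cons_isCycle_iff, Walk.cons_isPath_iff]
    grind)
  simp at h

lemma not_pentagon {a b c d e : V} (h1 : G.Adj a b) (h2 : G.Adj b c) (h3 : G.Adj c d)
    (h4 : G.Adj d e) (h5 : G.Adj e a) : False := by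
  have n1 : a ≠ c := by rintro rfl; exact not_triangle hg h3 h4 h5
  have n2 : b ≠ d := by rintro rfl; exact not_triangle hg h1 h4 h5
  have n3 : c ≠ e := by rintro rfl; exact not_triangle hg h1 h2 h5
  have n4 : d ≠ a := by rintro rfl; exact not_triangle hg h1 h2 h3
  have n5 : e ≠ b := by rintro rfl; exact not_triangle hg h2 h3 h4
  have h := hg a (.cons h1 (.cons h2 (.cons h3 (.cons h4 (.cons h5 .nil))))) (by
    have := h1.ne; have := h2.ne; have := h3.ne; have := h4.ne; have := h5.ne
    simp [Walk.cons_isCycle_iff, Walk.cons_isPath_iff]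
    grind)
  simp at h

/-- The alternatives are the ways to backtrack. Without backtracking the walk is a cycle, as equal
opposite vertices would leave a triangle. -/
lemma hexagon_degenerate {a b c d e f : V} (h1 : G.Adj a b) (h2 : G.Adj b c) (h3 : G.Adj c d)
    (h4 : G.Adj d e) (h5 : G.Adj e f) (h6 : G.Adj f a) :
    a = c ∨ b = d ∨ c = e ∨ d = f ∨ e = a ∨ f = b := by
  by_contra hn
  have n1 : a ≠ d := by rintro rfl; exact not_triangle hg h1 h2 h3
  have n2 : b ≠ e := by rintro rfl; exact not_triangle hg h2 h3 h4
  have n3 : c ≠ f := by rintro rfl; exact not_triangle hg h3 h4 h5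
  have h := hg a (.cons h1 (.cons h2 (.cons h3 (.cons h4 (.cons h5 (.cons h6 .nil)))))) (by
    have := h1.ne; have := h2.ne; have := h3.ne; have := h4.ne; have := h5.ne; have := h6.ne
    simp [Walk.cons_isCycle_iff, Walk.cons_isPath_iff]
    grind)
  simp at h

end Girth

/-- `x a s p q t y` is a closed walk of length `7` without backtracking. -/
structure IsHeptagon (G : SimpleGraph V) (x a s p q t y : V) : Prop where
  xa : G.Adj x a
  as : G.Adj a s
  sp : G.Adj s p
  pq : G.Adj p q
  qt : G.Adj q t
  ty : G.Adj t y
  yx : G.Adj y x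
  ay : a ≠ y
  sx : s ≠ x
  pa : p ≠ a
  qy : q ≠ y
  tx : t ≠ x

namespace IsHeptagon

variable {x a s p q t y : V}

/-- The closed walk along a heptagon. -/
def walk (h : IsHeptagon G x a s p q t y) : G.Walk x x :=
  .cons h.xa (.cons h.as (.cons h.sp (.cons h.pq (.cons h.qt (.cons h.ty (.cons h.yx .nil))))))

/-- Equal vertices three steps apart leave a triangle. Of the seven pairs two steps apart, five are
excluded by hypothesis and the other two would leave a pentagon. -/
lemma nodup (hg : ∀ (a : V) (w : G.Walk a a), w.IsCycle → 7 ≤ w.length)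
    (h : IsHeptagon G x a s p q t y) : [x, a, s, p, q, t, y].Nodup := by
  obtain ⟨h1, h2, h3, h4, h5, h6, h7, n1, n2, n3, n4, n5⟩ := h
  have n6 : s ≠ q := by rintro rfl; exact not_pentagon hg h1 h2 h5 h6 h7
  have n7 : p ≠ t := by rintro rfl; exact not_pentagon hg h1 h2 h3 h6 h7
  have m1 : x ≠ p := by rintro rfl; exact not_triangle hg h1 h2 h3
  have m2 : a ≠ q := by rintro rfl; exact not_triangle hg h2 h3 h4
  have m3 : s ≠ t := by rintro rfl; exact not_triangle hg h3 h4 h5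
  have m4 : p ≠ y := by rintro rfl; exact not_triangle hg h4 h5 h6
  have m5 : q ≠ x := by rintro rfl; exact not_triangle hg h5 h6 h7
  have m6 : t ≠ a := by rintro rfl; exact not_triangle hg h6 h7 h1
  have m7 : y ≠ s := by rintro rfl; exact not_triangle hg h7 h1 h2
  have := h1.ne; have := h2.ne; have := h3.ne; have := h4.ne
  have := h5.ne; have := h6.ne; have := h7.ne
  simp only [List.nodup_cons, List.mem_cons, List.not_mem_nil, or_false, not_or, not_false_eq_true,
    List.nodup_nil, and_true]
  refine ⟨⟨?_, ?_, ?_, ?_, ?_, ?_⟩, ⟨?_, ?_, ?_, ?_, ?_⟩, ⟨?_, ?_, ?_, ?_⟩, ⟨?_, ?_, ?_⟩,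
    ⟨?_, ?_⟩, ?_⟩ <;> first | assumption | (apply Ne.symm; assumption)

lemma isCycle_walk (hg : ∀ (a : V) (w : G.Walk a a), w.IsCycle → 7 ≤ w.length)
    (h : IsHeptagon G x a s p q t y) : h.walk.IsCycle := by
  have hn := h.nodup hg
  simp only [List.nodup_cons, List.mem_cons, List.not_mem_nil, or_false, not_or,
    not_false_eq_true, List.nodup_nil, and_true] at hn
  simp [walk, Walk.cons_isCycle_iff, Walk.cons_isPath_iff]
  grind

lemma adj_toSubgraph_iff (h : IsHeptagon G x a s p q t y) (u w : V) :
    h.walk.toSubgraph.Adj u w ↔ s(u, w) ∈ [s(x, a), s(a, s), s(s, p), s(p, q), s(q, t), s(t, y),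
      s(y, x)] := by
  rw [← Subgraph.mem_edgeSet, Walk.mem_edges_toSubgraph]
  rfl

/-- A heptagon is determined by its edges. -/
lemma eq_of_toSubgraph_eq (hg : ∀ (a : V) (w : G.Walk a a), w.IsCycle → 7 ≤ w.length)
    {a' s' p' q' t' : V}
    (h : IsHeptagon G x a s p q t y) (h' : IsHeptagon G x a' s' p' q' t' y)
    (e : h.walk.toSubgraph = h'.walk.toSubgraph) :
    a = a' ∧ s = s' ∧ p = p' ∧ q = q' ∧ t = t' := by
  have hn := h.nodup hg
  simp only [List.nodup_cons, List.mem_cons, List.not_mem_nil, or_false, not_or,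
    not_false_eq_true, List.nodup_nil, and_true] at hn
  have hn' := h'.nodup hg
  simp only [List.nodup_cons, List.mem_cons, List.not_mem_nil, or_false, not_or,
    not_false_eq_true, List.nodup_nil, and_true] at hn'
  have key : ∀ u w, s(u, w) ∈ [s(x, a'), s(a', s'), s(s', p'), s(p', q'), s(q', t'), s(t', y),
      s(y, x)] → s(u, w) ∈ [s(x, a), s(a, s), s(s, p), s(p, q), s(q, t), s(t, y), s(y, x)] :=
    fun u w => by rw [← h.adj_toSubgraph_iff, ← h'.adj_toSubgraph_iff, e]; exact id
  simp only [List.mem_cons, List.not_mem_nil, or_false, Sym2.eq_iff] at key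
  -- Both heptagons contain the edge `y x`. Going round from `x`, the next edge is forced at each
  -- vertex.
  have e1 : a = a' := by have := key x a' (by simp); grind
  subst e1
  have e2 : s = s' := by have := key a s' (by simp); grind
  subst e2
  have e3 : p = p' := by have := key s p' (by simp); grind
  subst e3
  have e4 : q = q' := by have := key p q' (by simp); grind
  subst e4
  have e5 : t = t' := by have := key q t' (by simp); grind
  exact ⟨rfl, rfl, rfl, rfl, e5⟩

end IsHeptagon

lemma exists_isHeptagon_of_walk {x : V} (c : G.Walk x x) (hc : c.IsCycle) (hl : c.length = 7) :
    ∃ (a s p q t y : V) (h : IsHeptagon G x a s p q t y), h.walk = c := by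
  match c, hl with
  | .cons (v := a) h1 (.cons (v := s) h2 (.cons (v := p) h3 (.cons (v := q) h4
      (.cons (v := t) h5 (.cons (v := y) h6 (.cons h7 .nil)))))), _ =>
    have hn := hc.support_nodup
    simp at hn
    refine ⟨a, s, p, q, t, y, ⟨h1, h2, h3, h4, h5, h6, h7, ?_, ?_, ?_, ?_, ?_⟩, rfl⟩ <;> grind

lemma mem_cyclesThroughEdge_iff (hg : ∀ (a : V) (w : G.Walk a a), w.IsCycle → 7 ≤ w.length)
    {x y : V} (C : G.Subgraph) : C ∈ G.cyclesThroughEdge 7 s(x, y) ↔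
      ∃ (a s p q t : V) (h : IsHeptagon G x a s p q t y), h.walk.toSubgraph = C := by
  classical
  constructor
  · rintro ⟨⟨u, c, hc, hl, rfl⟩, he⟩
    rw [Walk.mem_edges_toSubgraph] at he
    have hx : x ∈ c.support := c.fst_mem_support_of_mem_edges he
    have he' : s(x, y) ∈ (c.rotate x hx).edges := (c.rotate_edges x hx).mem_iff.2 he
    obtain ⟨a, s, p, q, t, z, h, hw⟩ := exists_isHeptagon_of_walk (c.rotate x hx) (hc.rotate hx)
      (by simp [hl])
    rw [← hw] at he'
    have hn := h.nodup hg
    simp only [List.nodup_cons, List.mem_cons, List.not_mem_nil, or_false, not_or,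
      not_false_eq_true, List.nodup_nil, and_true] at hn
    have hy : y = a ∨ y = z := by
      simp [IsHeptagon.walk] at he'
      grind
    have hC : h.walk.toSubgraph = c.toSubgraph := by rw [hw, Walk.toSubgraph_rotate]
    -- A cycle that leaves `x` along the given edge is traversed backwards.
    rcases hy with rfl | rfl
    · refine ⟨z, t, q, p, s, ⟨h.yx.symm, h.ty.symm, h.qt.symm, h.pq.symm, h.sp.symm, h.as.symm,
        h.xa.symm, ?_, ?_, ?_, ?_, ?_⟩, ?_⟩
      on_goal 6 =>
        rw [← hC, ← Walk.toSubgraph_reverse h.walk]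
        rfl
      all_goals grind
    · exact ⟨a, s, p, q, t, h, hC⟩
  · rintro ⟨a, s, p, q, t, h, rfl⟩
    refine ⟨⟨x, h.walk, h.isCycle_walk hg, rfl, rfl⟩, ?_⟩
    rw [Subgraph.mem_edgeSet, h.adj_toSubgraph_iff]
    simp [Sym2.eq_swap]

/-! ### Counting heptagons by their 4-paths -/

/-- The pairs of edges that extend the `2`-path `a x y` to a `4`-path contained in a heptagon. -/
def closingPairs (G : SimpleGraph V) (a x y : V) : Set (V × V) :=
  {st | G.Adj a st.1 ∧ st.1 ≠ x ∧ G.Adj y st.2 ∧ st.2 ≠ x ∧ Closes G st.1 a x y st.2}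

/-- The `4`-paths contained in a heptagon whose second edge starts the dart from `x` to `y`. -/
def closingTriples (G : SimpleGraph V) (x y : V) : Set (V × V × V) :=
  {ast | G.Adj x ast.1 ∧ ast.1 ≠ y ∧ ast.2 ∈ closingPairs G ast.1 x y}

lemma ncard_closingPairs_comm (a x y : V) :
    (closingPairs G a x y).ncard = (closingPairs G y x a).ncard := by
  rw [← Set.ncard_image_of_injective _ Prod.swap_injective]
  congr 1
  ext ⟨s, t⟩
  simp only [closingPairs, Set.mem_image, Set.mem_ofPred_eq, Prod.exists, Prod.swap_prod_mk,
    Prod.mk.injEq]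
  constructor
  · rintro ⟨s', t', ⟨h1, h2, h3, h4, h5⟩, rfl, rfl⟩
    exact ⟨h3, h4, h1, h2, h5.symm⟩
  · rintro ⟨h1, h2, h3, h4, h5⟩
    exact ⟨t, s, ⟨h3, h4, h1, h2, h5.symm⟩, rfl, rfl⟩

/-- A heptagon is determined by any `4`-path it contains. -/
lemma IsHeptagon.toSubgraph_eq (hg : ∀ (a : V) (w : G.Walk a a), w.IsCycle → 7 ≤ w.length)
    {x a s p q t y a' s' p' q' t' : V} (h : IsHeptagon G x a s p q t y)
    (h' : IsHeptagon G x a' s' p' q' t' y) (ha : a = a') (hs : s = s') (ht : t = t') :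
    h.walk.toSubgraph = h'.walk.toSubgraph := by
  subst ha hs ht
  have hn := h.nodup hg
  have hn' := h'.nodup hg
  simp only [List.nodup_cons, List.mem_cons, List.not_mem_nil, or_false, not_or,
    not_false_eq_true, List.nodup_nil, and_true] at hn hn'
  have h6 := hexagon_degenerate hg h.sp h.pq h.qt h'.qt.symm h'.pq.symm h'.sp.symm
  have h4 : q = q' → s = q ∨ p = p' := by
    rintro rfl
    exact eq_or_eq_of_square hg h.sp h.pq h'.pq.symm h'.sp.symm
  have h4' : p = p' → p = t ∨ q = q' := by
    rintro rfl
    exact eq_or_eq_of_square hg h.pq h.qt h'.qt.symm h'.pq.symm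
  obtain ⟨rfl, rfl⟩ : p = p' ∧ q = q' := by grind
  rfl

/-- A heptagon through `x y` is sent to the 4-path `s a x y t` in it. This is injective because the
4-path determines the heptagon, and surjective because `Closes` supplies the two missing vertices.
-/
lemma encard_cyclesThroughEdge (hg : ∀ (a : V) (w : G.Walk a a), w.IsCycle → 7 ≤ w.length)
    {x y : V} (hxy : G.Adj x y) :
    (G.cyclesThroughEdge 7 s(x, y)).encard = (closingTriples G x y).encard := by
  have hS := fun C : G.cyclesThroughEdge 7 s(x, y) => (mem_cyclesThroughEdge_iff hg C.1).1 C.2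
  choose a s p q t h hC using hS
  refine Set.encard_congr (Equiv.ofBijective (fun C => ⟨(a C, s C, t C), (h C).xa, (h C).ay,
    (h C).as, (h C).sx, (h C).ty.symm, (h C).tx, p C, q C, (h C).sp, (h C).pa, (h C).pq,
    (h C).qt, (h C).qy⟩) ⟨?_, ?_⟩)
  · intro C C' e
    have e' := congrArg Subtype.val e
    simp only [Prod.mk.injEq] at e'
    exact Subtype.ext ((hC C).symm.trans
      (((h C).toSubgraph_eq hg (h C') e'.1 e'.2.1 e'.2.2).trans (hC C')))
  · rintro ⟨⟨a', s', t'⟩, h1, h2, h3, h4, h5, h6, p', q', h7, h8, h9, h10, h11⟩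
    have k : IsHeptagon G x a' s' p' q' t' y :=
      ⟨h1, h3, h7, h9, h10, h5.symm, hxy.symm, h2, h4, h8, h11, h6⟩
    let C : G.cyclesThroughEdge 7 s(x, y) :=
      ⟨k.walk.toSubgraph, (mem_cyclesThroughEdge_iff hg _).2 ⟨_, _, _, _, _, k, rfl⟩⟩
    obtain ⟨e1, e2, e3, e4, e5⟩ := (h C).eq_of_toSubgraph_eq hg k (hC C)
    exact ⟨C, by simp [e1, e2, e5]⟩

lemma ncard_closingTriples [Finite V] {x y a b : V} (T : Tri G x y a b) :
    (closingTriples G x y).ncard = (closingPairs G a x y).ncard + (closingPairs G b x y).ncard := by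
  have e : closingTriples G x y =
      Prod.mk a '' closingPairs G a x y ∪ Prod.mk b '' closingPairs G b x y := by
    ext ⟨c, st⟩
    simp only [closingTriples, Set.mem_ofPred_eq, Set.mem_union, Set.mem_image, Prod.mk.injEq]
    constructor
    · rintro ⟨h1, h2, h3⟩
      rcases T.of_ne h1 h2 with rfl | rfl
      exacts [Or.inl ⟨st, h3, rfl, rfl⟩, Or.inr ⟨st, h3, rfl, rfl⟩]
    · rintro (⟨_, h, rfl, rfl⟩ | ⟨_, h, rfl, rfl⟩)
      exacts [⟨T.rot.adj, T.pq.symm, h⟩, ⟨T.rot.rot.adj, T.pr.symm, h⟩]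
  rw [e, Set.ncard_union_eq, Set.ncard_image_of_injective _ (Prod.mk_right_injective a),
    Set.ncard_image_of_injective _ (Prod.mk_right_injective b)]
  rw [Set.disjoint_left]
  rintro _ ⟨_, -, rfl⟩ ⟨_, -, h⟩
  exact T.qr (congrArg Prod.fst h).symm

lemma exists_gap [Finite V] {a x y : V} (hc : (closingPairs G a x y).ncard = 3)
    {s1 s2 t1 t2 : V} (Ta : Tri G a x s1 s2) (Ty : Tri G y x t1 t2) :
    ∃ s t, G.Adj a s ∧ s ≠ x ∧ G.Adj y t ∧ t ≠ x ∧ ¬ Closes G s a x y t ∧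
      ∀ s' t', G.Adj a s' → s' ≠ x → G.Adj y t' → t' ≠ x → ¬ Closes G s' a x y t' →
        s' = s ∧ t' = t := by
  -- There are four extensions and three close, so the complement is a singleton.
  have hP : ({s1, s2} ×ˢ {t1, t2} : Set (V × V)).ncard = 4 := by
    rw [Set.ncard_prod, Set.ncard_pair Ta.qr, Set.ncard_pair Ty.qr]
  have hsub : closingPairs G a x y ⊆ {s1, s2} ×ˢ {t1, t2} := fun st h =>
    ⟨Ta.of_ne h.1 h.2.1, Ty.of_ne h.2.2.1 h.2.2.2.1⟩
  have hd := Set.ncard_sdiff hsub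
  rw [hP, hc] at hd
  obtain ⟨⟨s, t⟩, hst⟩ := Set.ncard_eq_one.1 hd
  have hmem : ∀ s' t', G.Adj a s' → s' ≠ x → G.Adj y t' → t' ≠ x → ¬ Closes G s' a x y t' →
      (s', t') ∈ ({(s, t)} : Set (V × V)) := fun s' t' h1 h2 h3 h4 h5 => by
    rw [← hst]
    exact ⟨⟨Ta.of_ne h1 h2, Ty.of_ne h3 h4⟩, fun h => h5 h.2.2.2.2⟩
  have h0 : (s, t) ∈ ({s1, s2} ×ˢ {t1, t2} : Set (V × V)) \ closingPairs G a x y := by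
    rw [hst]; rfl
  obtain ⟨⟨hs, ht⟩, hn⟩ := h0
  have hs' : G.Adj a s ∧ s ≠ x := by
    rcases hs with h | h <;> (simp only at h; subst h)
    exacts [⟨Ta.rot.adj, Ta.pq.symm⟩, ⟨Ta.rot.rot.adj, Ta.pr.symm⟩]
  have ht' : G.Adj y t ∧ t ≠ x := by
    rcases ht with h | h <;> (simp only at h; subst h)
    exacts [⟨Ty.rot.adj, Ty.pq.symm⟩, ⟨Ty.rot.rot.adj, Ty.pr.symm⟩]
  refine ⟨s, t, hs'.1, hs'.2, ht'.1, ht'.2, fun h => hn ⟨hs'.1, hs'.2, ht'.1, ht'.2, h⟩, ?_⟩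
  intro s' t' h1 h2 h3 h4 h5
  simpa using hmem s' t' h1 h2 h3 h4 h5

lemma exists_tri [Fintype V] [DecidableRel G.Adj] (h : G.IsRegularOfDegree 3) {v p : V}
    (hp : G.Adj v p) : ∃ q r, Tri G v p q r := by
  classical
  obtain ⟨a, b, c, hab, hac, hbc, hs⟩ := Finset.card_eq_three.1 (h v)
  have hm : ∀ x, G.Adj v x ↔ x = a ∨ x = b ∨ x = c := fun x => by
    rw [← mem_neighborFinset, hs]; simp
  have T : Tri G v a b c := ⟨hab, hac, hbc, hm⟩
  rcases (hm p).1 hp with rfl | rfl | rfl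
  exacts [⟨_, _, T⟩, ⟨_, _, T.rot⟩, ⟨_, _, T.rot.rot⟩]

lemma IsEdgeGirthRegular.hasUniqueGaps [Fintype V] [DecidableRel G.Adj] {v : ℕ}
    (h : G.IsEdgeGirthRegular v 3 7 6) : HasUniqueGaps G := by
  have hg : ∀ (a : V) (w : G.Walk a a), w.IsCycle → 7 ≤ w.length := fun a w hw => by
    have := le_egirth.1 h.girth_eq.ge a w hw
    exact_mod_cast this
  have htri : ∀ {v p}, G.Adj v p → ∃ q r, Tri G v p q r := exists_tri h.regular
  have hcount : ∀ {x y a b}, Tri G x y a b →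
      (closingPairs G a x y).ncard + (closingPairs G b x y).ncard = 6 := fun {x y a b} T => by
    rw [← ncard_closingTriples T, Set.ncard, ← encard_cyclesThroughEdge hg T.adj,
      h.cycles_eq _ T.adj]
    rfl
  refine ⟨not_triangle hg, eq_or_eq_of_square hg, not_pentagon hg, hexagon_degenerate hg, htri, ?_⟩
  intro a x y hxa hxy hay
  obtain ⟨s1, s2, Ta⟩ := htri hxa.symm
  obtain ⟨t1, t2, Ty⟩ := htri hxy.symm
  refine exists_gap ?_ Ta Ty
  obtain ⟨b, T⟩ : ∃ b, Tri G x y a b := by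
    obtain ⟨b, c, T⟩ := htri hxy
    rcases T.of_ne hxa hay with rfl | rfl
    exacts [⟨_, T⟩, ⟨_, T.swap.rot⟩]
  -- One equation for each edge at `x`: the counts of the three 2-paths centred there have pairwise
  -- sums 6, so each is 3.
  have h1 := hcount T
  have h2 := hcount T.rot
  have h3 := hcount T.rot.rot
  have e1 := ncard_closingPairs_comm (G := G) a x y
  have e2 := ncard_closingPairs_comm (G := G) b x y
  have e3 := ncard_closingPairs_comm (G := G) a x b
  omega

end SimpleGraph

open SimpleGraph in
theorem mainTheorem1 {V : Type*} [Fintype V] (G : SimpleGraph V) [DecidableRel G.Adj] (v : ℕ) :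
    ¬ G.IsEdgeGirthRegular v 3 7 6 := by
  intro h
  -- Finite girth provides a cycle, hence a vertex with a neighbour; this excludes the empty graph.
  have hcyc : ¬ G.IsAcyclic := fun hG => by
    have := egirth_eq_top.2 hG
    rw [h.girth_eq] at this
    exact absurd this (by simp)
  obtain ⟨x, w, hw⟩ : ∃ (x : V) (w : G.Walk x x), w.IsCycle := by
    simpa [IsAcyclic] using hcyc
  obtain ⟨p, hp⟩ : ∃ p, G.Adj x p := ⟨_, w.adj_snd hw.not_nil⟩
  obtain ⟨q, r, T⟩ := exists_tri h.regular hp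
  exact h.hasUniqueGaps.not_tri T
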